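/- For each integer \(n\ge 1\), let \((Y^{(n)}_t)_{t\ge 0}\) be the continuous-time simple random walk on \(\mathbb{Z}_n=\mathbb{Z}/n\mathbb{Z}\) which takes steps with rate \(n^2\) (that is, the successive holding times are independent exponential variables with rate \(n^2\), and each step is \(+1\) or \(-1\) with probability \(1/2\), independently of everything else), with \(Y^{(n)}_0\) uniformly distributed on \(\mathbb{Z}_n\). A sequence of functions \(f_n:\mathbb{Z}_n\to\{-1,1\}\), \(n\ge 1\), is called - nondegenerate if \(-1<\liminf_{n\to\infty}\mathbb{E}[f_n(Y^{(n)}_0)]\le\limsup_{n\to\infty}\mathbb{E}[f_n(Y^{(n)}_0)]<1\); - noise stable if \(\lim_{\varepsilon\to 0^+}\sup_{n\ge 1} P[f_n(Y^{(n)}_0)\ne f_n(Y^{(n)}_\varepsilon)]=0\); - volatile if for every \(\delta>0\), \(\lim_{n\to\infty}P[\tau_{\partial f_n}>\delta]=0\), where \(\tau_{\partial f_n}=\inf\{t\ge 0: f_n(Y^{(n)}_t)\ne f_n(Y^{(n)}_0)\}\) (with \(\inf\emptyset=\infty\)). Two such sequences \((f_n)\), \((g_n)\) are called \(o(1)\)-close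 if \(\lim_{n\to\infty}P[f_n(Y^{(n)}_0)\ne g_n(Y^{(n)}_0)]=0\). **Proposition.** There is a nondegenerate, noise stable and volatile sequence of functions \(f_n:\mathbb{Z}_n\to\{-1,1\}\) that is not \(o(1)\)-close to any non-volatile sequence of functions \(g_n:\mathbb{Z}_n\to\{-1,1\}\). -/

import Mathlib

open MeasureTheory ProbabilityTheory Filter Topology
open scoped NNReal ENNReal

namespace CircleWalk

/-- The values `{-1, 1}` are modelled by the units of `ℤ`. -/
abbrev Sgn : Type := ℤˣ

/-- A sequence of functions `f n : ℤ/nℤ → {-1, 1}`, for `n = 1, 2, 3, …`. -/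
abbrev FunSeq : Type := ∀ n : ℕ+, ZMod n → Sgn

/-- The sample space carrying the walk on `ℤ/nℤ`: a starting point, the successive steps, and the
successive holding times. -/
abbrev Path (n : ℕ+) : Type := ZMod n × (ℕ → Sgn) × (ℕ → ℝ)

noncomputable section

instance isProbabilityMeasure_holding (n : ℕ+) :
    IsProbabilityMeasure (expMeasure (((n : ℕ) : ℝ) ^ 2)) :=
  isProbabilityMeasure_expMeasure (pow_pos (Nat.cast_pos.mpr n.pos) 2)

/-- The probability measure on the sample space: the starting point is uniform on `ℤ/nℤ`, the steps
are independent and uniform on `{-1, 1}`, the holding times are independent and exponential with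
rate `n ^ 2`, and the starting point, the steps and the holding times are independent. -/
def P (n : ℕ+) : Measure (Path n) :=
  (uniformOn (Set.univ : Set (ZMod n))).prod
    ((Measure.infinitePi fun _ : ℕ => uniformOn (Set.univ : Set Sgn)).prod
      (Measure.infinitePi fun _ : ℕ => expMeasure (((n : ℕ) : ℝ) ^ 2)))

instance isProbabilityMeasure_P (n : ℕ+) : IsProbabilityMeasure (P n) := by
  unfold P; infer_instance

/-- The number of steps taken up to and including time `t`; the step with index `m` is taken at the
time `T 0 + ⋯ + T m`. (On the null event that infinitely many steps are taken by time `t` the value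
is irrelevant.) -/
def numSteps {n : ℕ+} (t : ℝ≥0) (ω : Path n) : ℕ :=
  {m : ℕ | ∑ i ∈ Finset.range (m + 1), ω.2.2 i ≤ (t : ℝ)}.ncard

/-- The continuous time simple random walk on `ℤ/nℤ` which takes steps with rate `n ^ 2`, started
from the uniform distribution. -/
def Y (n : ℕ+) (t : ℝ≥0) (ω : Path n) : ZMod n :=
  ω.1 + ∑ i ∈ Finset.range (numSteps t ω), ((ω.2.1 i : ℤ) : ZMod n)

/-- The expectation of `f (Y 0)`. -/
def mean (n : ℕ+) (f : ZMod n → Sgn) : ℝ :=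
  ∫ ω, (((f (Y n 0 ω) : Sgn) : ℤ) : ℝ) ∂(P n)

def Nondegenerate (f : FunSeq) : Prop :=
  -1 < liminf (fun n : ℕ+ => mean n (f n)) atTop ∧
    liminf (fun n : ℕ+ => mean n (f n)) atTop ≤ limsup (fun n : ℕ+ => mean n (f n)) atTop ∧
    limsup (fun n : ℕ+ => mean n (f n)) atTop < 1

def NoiseStable (f : FunSeq) : Prop :=
  Tendsto (fun ε : ℝ≥0 => ⨆ n : ℕ+, P n {ω | f n (Y n 0 ω) ≠ f n (Y n ε ω)}) (𝓝[>] 0) (𝓝 0)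

/-- The hitting time of the set `{x | f x ≠ f (Y 0)}`, with value `⊤` if it is never hit. -/
def tau (n : ℕ+) (f : ZMod n → Sgn) (ω : Path n) : WithTop ℝ≥0 :=
  hittingAfter (Y n) {x | f x ≠ f (Y n 0 ω)} 0 ω

def Volatile (f : FunSeq) : Prop :=
  ∀ δ : ℝ≥0, 0 < δ →
    Tendsto (fun n : ℕ+ => P n {ω | (δ : WithTop ℝ≥0) < tau n (f n) ω}) atTop (𝓝 0)

/-- `o(1)`-closeness of two sequences of functions. -/
def Close (f g : FunSeq) : Prop :=
  Tendsto (fun n : ℕ+ => P n {ω | f n (Y n 0 ω) ≠ g n (Y n 0 ω)}) atTop (𝓝 0)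

end

end CircleWalk

/-! The function is built in layers. Starting from the constant `1`, layer `k` overwrites an arc of
length about `n / 4 ^ (k + 1)` with a sign, and the prescriptions (start `j / R` of the circle,
sign) are enumerated so that each recurs infinitely often. All layers after the `k`-th together
cover at most a third of the length of its arc, up to rounding, so most of every fixed layer
survives.

Robust volatility: for fixed `R`, any arc of length about `2 * n / R` contains, for each sign, a
layer arc of that sign whose index is bounded independently of `n`. A function `g` constant on such
an arc therefore differs from `f` on a fraction of the points bounded below in terms of `R`
(`exists_le_mul_disagree_layered`). Hence a `g` that is `o(1)`-close to `f` is eventually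
nonconstant on all these arcs. In time `δ` the walk typically travels a distance of order `n * √δ`,
so for large `R` it meets both values of `g` (`P_lt_tau_le`). Thus every `g` close to `f`, including
`f` itself, is volatile. Comparing `f` with constants gives nondegeneracy.

Noise stability: the first `K` layers approximate `f` up to a fraction `4 ^ (-K) / 3` and have at
most `2 * K` sign changes, each costing `O(√t)` by a second moment bound on the displacement
(`P_ne_Y_le`). -/

namespace CircleWalk

/-! ### Arcs of the discrete circle -/

section Arc

variable {n : ℕ}

/-- The set of `l` consecutive points of `ℤ/nℤ` starting at `a`. -/
def arc (a : ZMod n) (l : ℕ) : Finset (ZMod n) :=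
  (Finset.range l).image fun i : ℕ => a + (i : ZMod n)

lemma mem_arc {a x : ZMod n} {l : ℕ} : x ∈ arc a l ↔ ∃ i < l, a + (i : ZMod n) = x := by
  simp [arc]

lemma card_arc_le (a : ZMod n) (l : ℕ) : (arc a l).card ≤ l :=
  Finset.card_image_le.trans (by simp)

lemma card_arc (a : ZMod n) {l : ℕ} (hl : l ≤ n) : (arc a l).card = l := by
  rw [arc, Finset.card_image_of_injOn, Finset.card_range]
  intro i hi j hj h
  simp only [Finset.coe_range, Set.mem_Iio] at hi hj
  have h' : (i : ZMod n) = (j : ZMod n) := by simpa using h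
  rw [ZMod.natCast_eq_natCast_iff'] at h'
  rwa [Nat.mod_eq_of_lt (by omega), Nat.mod_eq_of_lt (by omega)] at h'

end Arc

/-! ### Counting disagreements and sign changes -/

section Disagreement

variable {n : ℕ} [NeZero n]

/-- The number of points at which two functions on `ℤ/nℤ` differ. -/
def disagree (f g : ZMod n → Sgn) : ℕ := (Finset.univ.filter fun x => f x ≠ g x).card

lemma disagree_self (f : ZMod n → Sgn) : disagree f f = 0 := by simp [disagree]

lemma disagree_comm (f g : ZMod n → Sgn) : disagree f g = disagree g f := by
  simp only [disagree, ne_comm]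

lemma disagree_triangle (f g h : ZMod n → Sgn) :
    disagree f h ≤ disagree f g + disagree g h := by
  classical
  refine (Finset.card_le_card ?_).trans (Finset.card_union_le _ _)
  intro x
  simp only [Finset.mem_filter, Finset.mem_union, Finset.mem_univ, true_and]
  intro hx
  by_contra! hc
  exact hx (hc.1.trans hc.2)

lemma disagree_translate (f g : ZMod n → Sgn) (a : ZMod n) :
    disagree (fun x => f (x + a)) (fun x => g (x + a)) = disagree f g := by
  refine Finset.card_bij (fun x _ => x + a) ?_ ?_ ?_
  · simp
  · simp
  · intro y hy
    exact ⟨y - a, by simpa using hy, by simp⟩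

lemma disagree_natCast_translate_le (f : ZMod n → Sgn) (s : ℕ) :
    disagree f (fun x => f (x + (s : ZMod n))) ≤ s * disagree f (fun x => f (x + 1)) := by
  induction s with
  | zero => simp [disagree_self]
  | succ s ih =>
    refine (disagree_triangle _ (fun x => f (x + (s : ZMod n))) _).trans ?_
    have h := disagree_translate f (fun x => f (x + 1)) (s : ZMod n)
    have e : (fun x : ZMod n => f (x + ((s + 1 : ℕ) : ZMod n)))
        = fun x => f (x + (s : ZMod n) + 1) := by
      funext x; push_cast; rw [add_assoc]
    rw [e, h]
    linarith

lemma disagree_intCast_translate_le (f : ZMod n → Sgn) (s : ℤ) :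
    disagree f (fun x => f (x + (s : ZMod n))) ≤ s.natAbs * disagree f (fun x => f (x + 1)) := by
  obtain ⟨m, rfl | rfl⟩ := s.eq_nat_or_neg
  · simpa using disagree_natCast_translate_le f m
  · have h := disagree_translate f (fun x => f (x + ((-(m : ℤ) : ℤ) : ZMod n))) (m : ZMod n)
    rw [← h, disagree_comm]
    simpa using disagree_natCast_translate_le f m

/-- New sign changes can only appear across the two ends of the arc, that is, at `x = a - 1` and `x
= a + l - 1`. -/
lemma disagree_arc_translate_le (a : ZMod n) (l : ℕ) (s : Sgn) (f : ZMod n → Sgn) :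
    disagree (fun x => if x ∈ arc a l then s else f x)
      (fun x => if x + 1 ∈ arc a l then s else f (x + 1))
      ≤ disagree f (fun x => f (x + 1)) + 2 := by
  classical
  refine (Finset.card_le_card (t := (Finset.univ.filter fun x => f x ≠ f (x + 1)) ∪
    {a - 1, a + (l : ZMod n) - 1}) ?_).trans
    ((Finset.card_union_le _ _).trans (Nat.add_le_add_left Finset.card_le_two _))
  intro x
  simp only [Finset.mem_filter, Finset.mem_union, Finset.mem_univ, true_and, Finset.mem_insert,
    Finset.mem_singleton]
  intro hx
  by_contra! hc
  obtain ⟨h1, h2, h3⟩ := hc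
  have key : x ∈ arc a l ↔ x + 1 ∈ arc a l := by
    simp only [mem_arc]
    constructor
    · rintro ⟨i, hi, rfl⟩
      refine ⟨i + 1, ?_, by push_cast; ring⟩
      rcases Nat.lt_or_ge (i + 1) l with h | h
      · exact h
      · obtain rfl : l = i + 1 := by omega
        exact absurd (by push_cast; ring) h3
    · rintro ⟨i, hi, hx'⟩
      cases i with
      | zero => exact absurd (by rw [eq_sub_iff_add_eq, ← hx']; simp) h2
      | succ i => exact ⟨i, by omega, by push_cast at hx'; rw [← add_assoc] at hx'
                                         exact add_right_cancel hx'⟩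
  by_cases h : x ∈ arc a l
  · simp [h, key.1 h] at hx
  · simp [h, mt key.2 h, h1] at hx

/-- Going forward from `x`, some grid point `j * n / R` occurs within `n / R` steps, which leaves
room for a further `n / R` points. -/
lemma exists_arc_subset {R : ℕ} (hR : 0 < R) (x : ZMod n) :
    ∃ j ≤ R, ∀ l ≤ n / R, arc ((j * n / R : ℕ) : ZMod n) l ⊆ arc x (2 * (n / R) + 1) := by
  have hn : 0 < n := Nat.pos_of_ne_zero (NeZero.ne n)
  set v := x.val with hv
  have hvn : v < n := ZMod.val_lt x
  -- This is `v * R / n` rounded up. The value `j = R` can occur; its grid point is `n`, which wraps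
  -- around to `0`.
  set j := (v * R + (n - 1)) / n with hj
  have hj1 : v * R ≤ j * n := by
    have := Nat.lt_div_mul_add (a := v * R + (n - 1)) hn
    rw [← hj] at this
    omega
  have hj2 : j * n ≤ v * R + (n - 1) := Nat.div_mul_le_self _ _
  refine ⟨j, ?_, fun l hl y hy => ?_⟩
  · have h1 : (v + 1) * R ≤ n * R := Nat.mul_le_mul_right _ hvn
    have h2 : (v + 1) * R = v * R + R := by ring
    have h3 : (R + 1) * n = n * R + n := by ring
    have : j * n < (R + 1) * n := by omega
    exact Nat.lt_succ_iff.1 (Nat.lt_of_mul_lt_mul_right this)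
  · have h1 : v ≤ j * n / R := (Nat.le_div_iff_mul_le hR).2 hj1
    have h2 : j * n / R ≤ v + n / R := by
      calc j * n / R ≤ (n + v * R) / R := Nat.div_le_div_right (by omega)
        _ = v + n / R := by rw [Nat.add_mul_div_right _ _ hR]; ring
    rw [mem_arc] at hy ⊢
    obtain ⟨i, hi, rfl⟩ := hy
    refine ⟨j * n / R - v + i, by omega, ?_⟩
    have hx : x = (v : ZMod n) := (ZMod.natCast_zmod_val x).symm
    rw [hx]
    push_cast [Nat.cast_sub h1]
    ring

end Disagreement

/-! ### The layered functions -/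

section Layered

/-- The function on `ℤ/nℤ` which is obtained from the constant `1` by overwriting, successively for
`k < K`, the values on an arc of length `n / 4 ^ (k + 1)` starting near `j * n / R` with a sign `s`,
where `((j, R), s) = d k`. -/
def layered (d : ℕ → (ℕ × ℕ) × Sgn) (n : ℕ) [NeZero n] : ℕ → ZMod n → Sgn
  | 0 => 1
  | k + 1 => fun x =>
    if x ∈ arc (((d k).1.1 * n / (d k).1.2 : ℕ) : ZMod n) (n / 4 ^ (k + 1)) then (d k).2
    else layered d n k x

variable (d : ℕ → (ℕ × ℕ) × Sgn) (n : ℕ) [NeZero n]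

lemma disagree_layered_succ_le (K : ℕ) :
    disagree (layered d n K) (layered d n (K + 1)) ≤ n / 4 ^ (K + 1) := by
  refine (Finset.card_le_card ?_).trans
    (card_arc_le (((d K).1.1 * n / (d K).1.2 : ℕ) : ZMod n) (n / 4 ^ (K + 1)))
  intro x hx
  by_contra hc
  simp [layered, hc] at hx

/-- The bound is the geometric sum of the layer sizes `n / 4 ^ (k + 1)` over `K ≤ k < M`. -/
lemma disagree_layered_le {K M : ℕ} (h : K ≤ M) :
    (disagree (layered d n K) (layered d n M) : ℝ) ≤ n / 3 * (1 / 4 ^ K - 1 / 4 ^ M) := by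
  induction M, h using Nat.le_induction with
  | base => simp [disagree_self]
  | succ M hKM ih =>
    have h1 : (disagree (layered d n K) (layered d n (M + 1)) : ℝ) ≤
        disagree (layered d n K) (layered d n M) +
          disagree (layered d n M) (layered d n (M + 1)) := by
      exact_mod_cast disagree_triangle _ _ _
    have h2 : (disagree (layered d n M) (layered d n (M + 1)) : ℝ) ≤ n / 4 ^ (M + 1) := by
      calc (disagree (layered d n M) (layered d n (M + 1)) : ℝ)
          ≤ ((n / 4 ^ (M + 1) : ℕ) : ℝ) := by exact_mod_cast disagree_layered_succ_le d n M
        _ ≤ n / 4 ^ (M + 1) := by exact_mod_cast Nat.cast_div_le (α := ℝ)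
    have h3 : (n : ℝ) / 3 * (1 / 4 ^ K - 1 / 4 ^ M) + n / 4 ^ (M + 1)
        = n / 3 * (1 / 4 ^ K - 1 / 4 ^ (M + 1)) := by
      field_simp
      ring
    linarith

lemma disagree_layered_le_div (K M : ℕ) (h : K ≤ M) :
    (disagree (layered d n K) (layered d n M) : ℝ) ≤ n / 3 / 4 ^ K := by
  refine (disagree_layered_le d n h).trans ?_
  rw [div_eq_mul_one_div (n / 3 : ℝ)]
  gcongr
  have : (0 : ℝ) ≤ 1 / 4 ^ M := by positivity
  linarith

lemma disagree_layered_translate_le (K : ℕ) :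
    disagree (layered d n K) (fun x => layered d n K (x + 1)) ≤ 2 * K := by
  induction K with
  | zero => simp [layered, disagree]
  | succ K ih =>
    refine (disagree_arc_translate_le _ _ _ _).trans ?_
    omega

/-- Just after layer `K` is written, `g` is wrong on its whole arc. Later layers repair at most a
third of `n / 4 ^ (K + 1)`, and rounding loses at most one point, which `hn` bounds by another
third. -/
lemma le_mul_disagree_layered {K : ℕ} (hn : 3 * 4 ^ (K + 1) ≤ n) {g : ZMod n → Sgn}
    (hg : ∀ x ∈ arc (((d K).1.1 * n / (d K).1.2 : ℕ) : ZMod n) (n / 4 ^ (K + 1)),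
      g x ≠ (d K).2) :
    n ≤ 3 * 4 ^ (K + 1) * disagree (layered d n n) g := by
  -- Only `n` layers are used, so layer `K` must be shown to be among them.
  have hK : K + 1 ≤ n := by
    have := Nat.lt_pow_self (n := K + 1) (a := 4) (by norm_num)
    omega
  have h1 : n / 4 ^ (K + 1) ≤ disagree (layered d n (K + 1)) g := by
    rw [← card_arc (((d K).1.1 * n / (d K).1.2 : ℕ) : ZMod n) (Nat.div_le_self n (4 ^ (K + 1)))]
    refine Finset.card_le_card fun x hx => ?_
    rw [Finset.mem_filter]
    simpa [layered, hx] using (hg x hx).symm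
  have h2 := disagree_triangle (layered d n (K + 1)) (layered d n n) g
  have h3 := disagree_layered_le_div d n (K + 1) n hK
  have h4 : (n : ℝ) / 4 ^ (K + 1) - 1 ≤ ((n / 4 ^ (K + 1) : ℕ) : ℝ) := by
    have := Nat.lt_floor_add_one ((n : ℝ) / ((4 ^ (K + 1) : ℕ) : ℝ))
    rw [Nat.floor_div_eq_div] at this
    push_cast at this
    linarith
  have h5 : ((n / 4 ^ (K + 1) : ℕ) : ℝ) ≤
      disagree (layered d n (K + 1)) (layered d n n) + disagree (layered d n n) g := by
    exact_mod_cast h1.trans h2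
  have h6 : (3 : ℝ) * 4 ^ (K + 1) ≤ n := by exact_mod_cast hn
  have hp : (0 : ℝ) < 4 ^ (K + 1) := by positivity
  have h7 : (n : ℝ) / 4 ^ (K + 1) - 1 - n / 3 / 4 ^ (K + 1) ≤ disagree (layered d n n) g := by
    linarith
  have h8 : (n : ℝ) ≤ 3 * 4 ^ (K + 1) * disagree (layered d n n) g := by
    have h9 := mul_le_mul_of_nonneg_left h7 (by positivity : (0 : ℝ) ≤ 3 * 4 ^ (K + 1))
    have h10 : 3 * (4 : ℝ) ^ (K + 1) * ((n : ℝ) / 4 ^ (K + 1) - 1 - n / 3 / 4 ^ (K + 1))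
        = 2 * n - 3 * 4 ^ (K + 1) := by
      field_simp
      ring
    linarith
  exact_mod_cast h8

end Layered

/-- If every value of `d` is attained infinitely often, then a function which is constant on an arc
of macroscopic length differs from the layered function on a positive fraction of the points. -/
lemma exists_le_mul_disagree_layered {d : ℕ → (ℕ × ℕ) × Sgn} (hd : ∀ p m, ∃ k ≥ m, d k = p)
    {R : ℕ} (hR : 0 < R) :
    ∃ C : ℕ, ∀ (n : ℕ) [NeZero n], C ≤ n → ∀ (g : ZMod n → Sgn) (x : ZMod n) (s : Sgn),
      (∀ y ∈ arc x (2 * (n / R) + 1), g y = s) → n ≤ C * disagree (layered d n n) g := by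
  choose k hk hdk using hd
  -- A bound on the layer index, uniform in `j` and in the sign; the sum crudely dominates both
  -- indices.
  set K : ℕ := (Finset.range (R + 1)).sup fun j => k ((j, R), 1) R + k ((j, R), -1) R with hK
  refine ⟨3 * 4 ^ (K + 1), fun n _ hn g x s hg => ?_⟩
  obtain ⟨j, hj, hsub⟩ := exists_arc_subset hR x
  have hle : k ((j, R), -s) R ≤ K := by
    have h1 : k ((j, R), 1) R + k ((j, R), -1) R ≤ K :=
      Finset.le_sup (f := fun j => k ((j, R), 1) R + k ((j, R), -1) R)
        (Finset.mem_range.2 (Nat.lt_succ_of_le hj))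
    rcases Int.units_eq_one_or s with rfl | rfl
    · omega
    · rw [neg_neg]; omega
  have hpow : 3 * 4 ^ (k ((j, R), -s) R + 1) ≤ 3 * 4 ^ (K + 1) := by gcongr; norm_num
  refine (le_mul_disagree_layered d n (hpow.trans hn) (g := g) fun y hy => ?_).trans
    (Nat.mul_le_mul_right _ hpow)
  rw [hdk] at hy ⊢
  -- The layer was chosen with index at least `R`, so its arc has length at most `n / R` and fits
  -- inside the given one.
  have hRle : R ≤ 4 ^ (k ((j, R), -s) R + 1) := by
    have h1 := hk ((j, R), -s) R
    have h2 := Nat.lt_pow_self (n := k ((j, R), -s) R + 1) (a := 4) (by norm_num)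
    omega
  rw [hg y (hsub _ (Nat.div_le_div_left hRle hR) hy)]
  rcases Int.units_eq_one_or s with rfl | rfl <;> simp

/-! ### Second moment and exit estimate for the walk on the integers -/

section Steps

instance discreteMeasurableSpace_sgn : DiscreteMeasurableSpace Sgn where
  forall_measurableSet s :=
    ⟨Units.val '' s, .of_discrete, Set.preimage_image_eq s Units.val_injective⟩

/-- The law of the steps of the walk. -/
noncomputable abbrev stepLaw : Measure (ℕ → Sgn) :=
  Measure.infinitePi fun _ : ℕ => uniformOn (Set.univ : Set Sgn)

/-- The position after `m` steps of the walk on `ℤ` started from `0`. -/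
def walk (σ : ℕ → Sgn) (m : ℕ) : ℤ := ∑ i ∈ Finset.range m, (σ i : ℤ)

/-- Change the sign of the step with index `j`. -/
def flip (j : ℕ) (σ : ℕ → Sgn) : ℕ → Sgn := fun i => if i = j then -σ i else σ i

lemma walk_zero (σ : ℕ → Sgn) : walk σ 0 = 0 := rfl

lemma walk_succ (σ : ℕ → Sgn) (m : ℕ) : walk σ (m + 1) = walk σ m + (σ m : ℤ) :=
  Finset.sum_range_succ _ _

lemma sgn_sq (s : Sgn) : (((s : ℤ) : ℝ)) ^ 2 = 1 := by
  rcases Int.units_eq_one_or s with rfl | rfl <;> simp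

lemma abs_walk_succ_le (σ : ℕ → Sgn) (m : ℕ) : |walk σ (m + 1)| ≤ |walk σ m| + 1 := by
  rw [walk_succ]
  refine (abs_add_le _ _).trans ?_
  rcases Int.units_eq_one_or (σ m) with h | h <;> simp [h]

lemma abs_walk_le (σ : ℕ → Sgn) (m : ℕ) : |walk σ m| ≤ m := by
  induction m with
  | zero => simp [walk_zero]
  | succ m ih => have := abs_walk_succ_le σ m; push_cast; linarith

lemma walk_flip {j m : ℕ} (h : m ≤ j) (σ : ℕ → Sgn) : walk (flip j σ) m = walk σ m := by
  refine Finset.sum_congr rfl fun i hi => ?_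
  have : i ≠ j := by have := Finset.mem_range.1 hi; omega
  simp [flip, this]

lemma measurable_walk (m : ℕ) : Measurable fun σ => walk σ m :=
  Finset.measurable_fun_sum _ fun i _ =>
    (Measurable.of_discrete (f := fun s : Sgn => (s : ℤ))).comp (measurable_pi_apply i)

lemma measurable_realWalk (m : ℕ) : Measurable fun σ => (walk σ m : ℝ) :=
  (Measurable.of_discrete (f := fun s : ℤ => (s : ℝ))).comp (measurable_walk m)

lemma measurable_realStep (m : ℕ) : Measurable fun σ : ℕ → Sgn => ((σ m : ℤ) : ℝ) :=
  (Measurable.of_discrete (f := fun s : Sgn => ((s : ℤ) : ℝ))).comp (measurable_pi_apply m)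

lemma map_neg_uniformOn_sgn :
    (uniformOn (Set.univ : Set Sgn)).map (fun s => -s) = uniformOn (Set.univ : Set Sgn) := by
  ext s hs
  rw [Measure.map_apply .of_discrete hs, uniformOn_univ, uniformOn_univ,
    Measure.count_apply .of_discrete, Measure.count_apply hs,
    show ((fun s : Sgn => -s) ⁻¹' s).encard = s.encard from
      Set.encard_preimage_of_bijective (Equiv.neg Sgn).bijective s]

lemma measurable_flip (j : ℕ) : Measurable (flip j) :=
  measurable_pi_lambda _ fun i => by
    by_cases h : i = j
    · simp only [flip, h, if_true]
      exact (Measurable.of_discrete (f := fun s : Sgn => -s)).comp (measurable_pi_apply j)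
    · simp only [flip, h, if_false]
      exact measurable_pi_apply i

lemma measurePreserving_flip (j : ℕ) : MeasurePreserving (flip j) stepLaw stepLaw := by
  refine ⟨measurable_flip j, ?_⟩
  have h := Measure.infinitePi_map_pi (fun _ : ℕ => uniformOn (Set.univ : Set Sgn))
    (f := fun i s => if i = j then -s else s) (fun i => .of_discrete)
  refine h.trans ?_
  congr 1
  funext i
  by_cases hi : i = j
  · simpa [hi] using map_neg_uniformOn_sgn
  · simp [hi]

/-- A step is centred and uncorrelated with any function of the other steps. -/
lemma integral_mul_step {j : ℕ} {F : (ℕ → Sgn) → ℝ} (hF : Measurable F)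
    (h : ∀ σ, F (flip j σ) = F σ) : ∫ σ, F σ * ((σ j : ℤ) : ℝ) ∂stepLaw = 0 := by
  have h1 : ∫ σ, F σ * ((σ j : ℤ) : ℝ) ∂stepLaw
      = ∫ σ, F (flip j σ) * ((flip j σ j : ℤ) : ℝ) ∂stepLaw := by
    conv_lhs => rw [← (measurePreserving_flip j).map_eq]
    exact integral_map (measurable_flip j).aemeasurable
      (hF.mul (measurable_realStep j)).aestronglyMeasurable
  have h2 : ∀ σ, F (flip j σ) * ((flip j σ j : ℤ) : ℝ) = -(F σ * ((σ j : ℤ) : ℝ)) := by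
    intro σ
    rw [h]
    simp [flip]
  simp_rw [h2, integral_neg] at h1
  linarith

lemma integrable_walk_sq (m : ℕ) : Integrable (fun σ => (walk σ m : ℝ) ^ 2) stepLaw := by
  refine Integrable.of_bound ((measurable_realWalk m).pow_const 2).aestronglyMeasurable
    ((m : ℝ) ^ 2) (ae_of_all _ fun σ => ?_)
  have h : |(walk σ m : ℝ)| ≤ m := by exact_mod_cast abs_walk_le σ m
  rw [Real.norm_eq_abs, abs_pow]
  gcongr

lemma integrable_mul_step {F : (ℕ → Sgn) → ℝ} (hF : Measurable F) {C : ℝ} (hC : ∀ σ, |F σ| ≤ C)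
    (j : ℕ) : Integrable (fun σ => F σ * ((σ j : ℤ) : ℝ)) stepLaw := by
  refine Integrable.of_bound (hF.mul (measurable_realStep j)).aestronglyMeasurable C
    (ae_of_all _ fun σ => ?_)
  have h : |((σ j : ℤ) : ℝ)| = 1 := by
    rcases Int.units_eq_one_or (σ j) with h | h <;> simp [h]
  rw [Real.norm_eq_abs, abs_mul, h, mul_one]
  exact hC σ

lemma integral_walk_sq (m : ℕ) : ∫ σ, (walk σ m : ℝ) ^ 2 ∂stepLaw = m := by
  induction m with
  | zero => simp [walk_zero]
  | succ m ih =>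
    have h : ∀ σ, (walk σ (m + 1) : ℝ) ^ 2
        = (walk σ m : ℝ) ^ 2 + 1 + 2 * (walk σ m : ℝ) * ((σ m : ℤ) : ℝ) := by
      intro σ
      have := sgn_sq (σ m)
      rw [walk_succ]
      push_cast
      linear_combination this
    simp_rw [h]
    have hb : ∀ σ, |2 * (walk σ m : ℝ)| ≤ 2 * m := by
      intro σ
      have h : |(walk σ m : ℝ)| ≤ m := by exact_mod_cast abs_walk_le σ m
      rw [abs_mul, abs_two]
      linarith
    have hm : Measurable fun σ => 2 * (walk σ m : ℝ) := (measurable_realWalk m).const_mul 2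
    have h1 : Integrable (fun σ => (walk σ m : ℝ) ^ 2 + 1) stepLaw :=
      (integrable_walk_sq m).add (integrable_const _)
    rw [integral_add h1
      (integrable_mul_step hm hb m), integral_add (integrable_walk_sq m) (integrable_const _), ih,
      integral_mul_step hm (fun σ => by rw [walk_flip le_rfl])]
    simp

/-- The event that the walk stays in `(-L, L)` for `m` steps. -/
def staysWithin (L : ℕ) (m : ℕ) : Set (ℕ → Sgn) := {σ | ∀ i ≤ m, |walk σ i| < L}

lemma measurableSet_staysWithin (L m : ℕ) : MeasurableSet (staysWithin L m) := by
  have : staysWithin L m = ⋂ i ∈ Finset.range (m + 1), {σ | |walk σ i| < L} := by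
    ext σ
    simp [staysWithin]
  rw [this]
  refine Finset.measurableSet_biInter _ fun i _ => ?_
  exact measurable_walk i (.of_discrete (s := {z : ℤ | |z| < L}))

lemma flip_mem_staysWithin {L m : ℕ} {σ : ℕ → Sgn} :
    flip m σ ∈ staysWithin L m ↔ σ ∈ staysWithin L m := by
  refine forall₂_congr fun i hi => ?_
  rw [walk_flip hi]

lemma staysWithin_antitone (L : ℕ) : Antitone (staysWithin L) :=
  fun _ _ h _ hσ i hi => hσ i (hi.trans h)

open Classical in
/-- The square of the walk stopped at the exit from `(-L, L)`. -/
noncomputable def stoppedSq (L m : ℕ) (σ : ℕ → Sgn) : ℝ :=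
  if σ ∈ staysWithin L m then (walk σ m : ℝ) ^ 2 else (L : ℝ) ^ 2

/-- Before the exit this expands the square. Since steps have size one, the exit occurs exactly at
`±L`, so freezing the value at `L ^ 2` involves no overshoot. -/
lemma stoppedSq_succ {L : ℕ} (m : ℕ) (σ : ℕ → Sgn) :
    stoppedSq L (m + 1) σ = stoppedSq L m σ + (staysWithin L m).indicator 1 σ +
      (staysWithin L m).indicator (fun σ => 2 * (walk σ m : ℝ)) σ * ((σ m : ℤ) : ℝ) := by
  by_cases h : σ ∈ staysWithin L m
  · have h1 : stoppedSq L (m + 1) σ = (walk σ (m + 1) : ℝ) ^ 2 := by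
      by_cases h' : σ ∈ staysWithin L (m + 1)
      · simp [stoppedSq, h']
      · have h2 : ¬ |walk σ (m + 1)| < L := fun hlt => h' fun i hi => by
          rcases Nat.lt_or_ge i (m + 1) with h3 | h3
          · exact h i (by omega)
          · rwa [show i = m + 1 by omega]
        have h3 := abs_walk_succ_le σ m
        have h4 := h m le_rfl
        have h5 : |walk σ (m + 1)| = L := by omega
        have h6 : |(walk σ (m + 1) : ℝ)| = L := by exact_mod_cast h5
        rw [stoppedSq, if_neg h', ← h6, sq_abs]
    have := sgn_sq (σ m)
    rw [h1, stoppedSq, if_pos h, Set.indicator_of_mem h, Set.indicator_of_mem h, walk_succ]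
    push_cast
    simp only [Pi.one_apply]
    linear_combination this
  · have h' : σ ∉ staysWithin L (m + 1) := fun h' => h (staysWithin_antitone L m.le_succ h')
    simp [stoppedSq, h, h']

lemma measurable_stoppedSq (L m : ℕ) : Measurable (stoppedSq L m) :=
  Measurable.ite (measurableSet_staysWithin L m) ((measurable_realWalk m).pow_const 2)
    measurable_const

lemma stoppedSq_nonneg (L m : ℕ) (σ : ℕ → Sgn) : 0 ≤ stoppedSq L m σ := by
  unfold stoppedSq
  split_ifs <;> positivity

lemma stoppedSq_le (L m : ℕ) (σ : ℕ → Sgn) : stoppedSq L m σ ≤ (L : ℝ) ^ 2 := by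
  unfold stoppedSq
  split_ifs with h
  · have h1 : |(walk σ m : ℝ)| ≤ L := by exact_mod_cast (h m le_rfl).le
    rw [← sq_abs]
    gcongr
  · rfl

lemma integrable_stoppedSq (L m : ℕ) : Integrable (stoppedSq L m) stepLaw :=
  Integrable.of_bound (measurable_stoppedSq L m).aestronglyMeasurable ((L : ℝ) ^ 2)
    (ae_of_all _ fun σ => by
      rw [Real.norm_of_nonneg (stoppedSq_nonneg L m σ)]
      exact stoppedSq_le L m σ)

lemma integral_stoppedSq_succ (L m : ℕ) :
    ∫ σ, stoppedSq L (m + 1) σ ∂stepLaw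
      = ∫ σ, stoppedSq L m σ ∂stepLaw + stepLaw.real (staysWithin L m) := by
  have hA := measurableSet_staysWithin L m
  have hm : Measurable ((staysWithin L m).indicator fun σ => 2 * (walk σ m : ℝ)) :=
    ((measurable_realWalk m).const_mul 2).indicator hA
  have hb : ∀ σ, |(staysWithin L m).indicator (fun σ => 2 * (walk σ m : ℝ)) σ| ≤ 2 * m := by
    intro σ
    have h : |(walk σ m : ℝ)| ≤ m := by exact_mod_cast abs_walk_le σ m
    by_cases hσ : σ ∈ staysWithin L m
    · rw [Set.indicator_of_mem hσ, abs_mul, abs_two]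
      linarith
    · rw [Set.indicator_of_notMem hσ, abs_zero]
      positivity
  have h1 : Integrable ((staysWithin L m).indicator (1 : (ℕ → Sgn) → ℝ)) stepLaw :=
    (integrable_const (1 : ℝ)).indicator hA
  simp_rw [stoppedSq_succ]
  have h2 : Integrable
      (fun σ => stoppedSq L m σ + (staysWithin L m).indicator (1 : (ℕ → Sgn) → ℝ) σ) stepLaw :=
    (integrable_stoppedSq L m).add h1
  rw [integral_add h2 (integrable_mul_step hm hb m),
    integral_add (integrable_stoppedSq L m) h1, integral_mul_step hm, integral_indicator_one hA,
    add_zero]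
  intro σ
  by_cases hσ : σ ∈ staysWithin L m
  · rw [Set.indicator_of_mem hσ, Set.indicator_of_mem (flip_mem_staysWithin.2 hσ),
      walk_flip le_rfl]
  · rw [Set.indicator_of_notMem hσ, Set.indicator_of_notMem (mt flip_mem_staysWithin.1 hσ)]

/-- Optional stopping: the expected stopped square grows by the survival probability at each step
but never exceeds `L ^ 2`. Survival probabilities decrease, so `m` copies of the last are at most
their sum. -/
lemma mul_measure_staysWithin_le (L m : ℕ) :
    m * stepLaw.real (staysWithin L m) ≤ (L : ℝ) ^ 2 := by
  have h : ∀ m, ∑ i ∈ Finset.range m, stepLaw.real (staysWithin L i)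
      ≤ ∫ σ, stoppedSq L m σ ∂stepLaw := by
    intro m
    induction m with
    | zero => simpa using integral_nonneg (stoppedSq_nonneg L 0)
    | succ m ih => rw [Finset.sum_range_succ, integral_stoppedSq_succ]; linarith
  calc m * stepLaw.real (staysWithin L m)
      = ∑ i ∈ Finset.range m, stepLaw.real (staysWithin L m) := by simp
    _ ≤ ∑ i ∈ Finset.range m, stepLaw.real (staysWithin L i) :=
        Finset.sum_le_sum fun i hi =>
          measureReal_mono (staysWithin_antitone L (Finset.mem_range.1 hi).le)
    _ ≤ ∫ σ, stoppedSq L m σ ∂stepLaw := h m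
    _ ≤ ∫ _, (L : ℝ) ^ 2 ∂stepLaw :=
        integral_mono (integrable_stoppedSq L m) (integrable_const _) (stoppedSq_le L m)
    _ = (L : ℝ) ^ 2 := by simp

end Steps

/-! ### Moments of the exponential law -/

section Exponential

variable {r : ℝ}

lemma expMeasure_eq_withDensity (r : ℝ) :
    expMeasure r = volume.withDensity (exponentialPDF r) := rfl

lemma measurable_exponentialPDF (r : ℝ) : Measurable (exponentialPDF r) :=
  (measurable_exponentialPDFReal r).ennreal_ofReal

lemma ae_pos_expMeasure (r : ℝ) : ∀ᵐ x ∂expMeasure r, 0 < x := by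
  rw [ae_iff, expMeasure_eq_withDensity]
  simp only [not_lt]
  change (volume.withDensity (exponentialPDF r)) (Set.Iic 0) = 0
  rw [withDensity_apply _ measurableSet_Iic, ← setLIntegral_congr Iio_ae_eq_Iic]
  exact lintegral_exponentialPDF_of_nonpos le_rfl

/-- On the half-line, `x` times the exponential density is `1 / r` times the Gamma density of shape
`2`. -/
lemma lintegral_ofReal_expMeasure (hr : 0 < r) :
    ∫⁻ x, ENNReal.ofReal x ∂expMeasure r = ENNReal.ofReal (1 / r) := by
  rw [expMeasure_eq_withDensity, lintegral_withDensity_eq_lintegral_mul _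
    (measurable_exponentialPDF r) ENNReal.measurable_ofReal]
  have h : ∀ x, (exponentialPDF r * fun x => ENNReal.ofReal x) x
      = ENNReal.ofReal (1 / r) * gammaPDF 2 r x := by
    intro x
    rw [Pi.mul_apply]
    rcases lt_or_ge x 0 with hx | hx
    · rw [exponentialPDF_of_neg hx, gammaPDF_of_neg hx, zero_mul, mul_zero]
    · rw [exponentialPDF_of_nonneg hx, gammaPDF_of_nonneg hx, ← ENNReal.ofReal_mul (by positivity),
        ← ENNReal.ofReal_mul (by positivity)]
      congr 1
      rw [show (2 : ℝ) - 1 = 1 by norm_num, Real.rpow_one, Real.rpow_two, Real.Gamma_two]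
      field_simp
  simp_rw [h]
  rw [lintegral_const_mul _ (show Measurable (gammaPDF 2 r) from
      (measurable_gammaPDFReal 2 r).ennreal_ofReal),
    lintegral_gammaPDF_eq_one two_pos hr, mul_one]

lemma mgf_expMeasure (hr : 0 < r) {l : ℝ} (hl : 0 ≤ l) :
    mgf id (expMeasure r) (-l) = r / (r + l) := by
  rw [mgf, integral_eq_lintegral_of_nonneg_ae (ae_of_all _ fun x => (Real.exp_pos _).le)
    (by fun_prop), expMeasure_eq_withDensity, lintegral_withDensity_eq_lintegral_mul _
    (measurable_exponentialPDF r) (by fun_prop)]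
  have h : ∀ x, (exponentialPDF r * fun x => ENNReal.ofReal (Real.exp (-l * id x))) x
      = ENNReal.ofReal (r / (r + l)) * exponentialPDF (r + l) x := by
    intro x
    rw [Pi.mul_apply]
    rcases lt_or_ge x 0 with hx | hx
    · rw [exponentialPDF_of_neg hx, exponentialPDF_of_neg hx, zero_mul, mul_zero]
    · rw [exponentialPDF_of_nonneg hx, exponentialPDF_of_nonneg hx,
        ← ENNReal.ofReal_mul (by positivity), ← ENNReal.ofReal_mul (by positivity)]
      congr 1
      rw [mul_assoc, ← Real.exp_add, show -(r * x) + -l * id x = -((r + l) * x) by simp; ring]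
      field_simp
  simp_rw [h]
  rw [lintegral_const_mul _ (measurable_exponentialPDF _),
    lintegral_exponentialPDF_eq_one (by positivity), mul_one, ENNReal.toReal_ofReal (by positivity)]

end Exponential

/-! ### Jump times and the number of jumps -/

section Holding

/-- The law of the holding times of the walk on `ℤ/nℤ`. -/
noncomputable abbrev holdLaw (n : ℕ+) : Measure (ℕ → ℝ) :=
  Measure.infinitePi fun _ : ℕ => expMeasure (((n : ℕ) : ℝ) ^ 2)

lemma rate_pos (n : ℕ+) : 0 < ((n : ℕ) : ℝ) ^ 2 := pow_pos (Nat.cast_pos.mpr n.pos) 2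

lemma ae_pos_holdLaw (n : ℕ+) : ∀ᵐ T ∂holdLaw n, ∀ i, 0 < T i := by
  rw [ae_all_iff]
  intro i
  exact (measurePreserving_eval_infinitePi
    (fun _ : ℕ => expMeasure (((n : ℕ) : ℝ) ^ 2)) i).quasiMeasurePreserving.ae
      (ae_pos_expMeasure _)

lemma measurable_partialSum (m : ℕ) :
    Measurable fun T : ℕ → ℝ => ∑ i ∈ Finset.range m, T i :=
  Finset.measurable_fun_sum _ fun i _ => measurable_pi_apply i

lemma holdLaw_lt_partialSum_le (n : ℕ+) (m : ℕ) {δ : ℝ} (hδ : 0 < δ) :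
    holdLaw n {T | δ < ∑ i ∈ Finset.range m, T i}
      ≤ ENNReal.ofReal (m / (((n : ℕ) : ℝ) ^ 2 * δ)) := by
  have hr := rate_pos n
  have hm : ∀ i : ℕ, Measurable fun T : ℕ → ℝ => ENNReal.ofReal (T i) := fun i =>
    (measurable_pi_apply i).ennreal_ofReal
  have h1 : ∫⁻ T, ∑ i ∈ Finset.range m, ENNReal.ofReal (T i) ∂holdLaw n
      = m * ENNReal.ofReal (1 / ((n : ℕ) : ℝ) ^ 2) := by
    rw [lintegral_finsetSum _ fun i _ => hm i]
    have : ∀ i, ∫⁻ T, ENNReal.ofReal (T i) ∂holdLaw n = ENNReal.ofReal (1 / ((n : ℕ) : ℝ) ^ 2) := by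
      intro i
      rw [← lintegral_ofReal_expMeasure hr]
      exact (measurePreserving_eval_infinitePi
        (fun _ : ℕ => expMeasure (((n : ℕ) : ℝ) ^ 2)) i).lintegral_comp ENNReal.measurable_ofReal
    simp [this]
  have h2 := mul_meas_ge_le_lintegral (μ := holdLaw n)
    (Finset.measurable_fun_sum (Finset.range m) fun i _ => hm i) (ENNReal.ofReal δ)
  rw [h1] at h2
  have h3 : {T : ℕ → ℝ | δ < ∑ i ∈ Finset.range m, T i}
      ⊆ {T | ENNReal.ofReal δ ≤ ∑ i ∈ Finset.range m, ENNReal.ofReal (T i)} := by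
    intro T hT
    refine (ENNReal.ofReal_le_ofReal (le_of_lt hT)).trans ?_
    exact Finset.le_sum_of_subadditive ENNReal.ofReal ENNReal.ofReal_zero.le
      (fun _ _ => ENNReal.ofReal_add_le) _ _
  refine (measure_mono h3).trans ?_
  rw [show (m : ℝ) / (((n : ℕ) : ℝ) ^ 2 * δ) = m * (1 / ((n : ℕ) : ℝ) ^ 2) / δ by field_simp,
    ENNReal.ofReal_div_of_pos hδ, ENNReal.ofReal_mul (by positivity), ENNReal.ofReal_natCast,
    ENNReal.le_div_iff_mul_le (Or.inl (by simpa using hδ)) (Or.inl ENNReal.ofReal_ne_top), mul_comm]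
  exact h2

/-- Chernoff's bound with parameter `-1 / t`, which produces the prefactor `exp 1`. -/
lemma holdLaw_partialSum_le_le (n : ℕ+) (m : ℕ) {t : ℝ} (ht : 0 < t) :
    holdLaw n {T | ∑ i ∈ Finset.range m, T i ≤ t}
      ≤ ENNReal.ofReal (Real.exp 1 *
        (((n : ℕ) : ℝ) ^ 2 / (((n : ℕ) : ℝ) ^ 2 + 1 / t)) ^ m) := by
  have hr := rate_pos n
  have hind : iIndepFun (fun (i : ℕ) (T : ℕ → ℝ) => T i) (holdLaw n) :=
    iIndepFun_infinitePi (X := fun _ => id) fun _ => measurable_id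
  have hmgf : mgf (∑ i ∈ Finset.range m, fun T : ℕ → ℝ => T i) (holdLaw n) (-(1 / t))
      = (((n : ℕ) : ℝ) ^ 2 / (((n : ℕ) : ℝ) ^ 2 + 1 / t)) ^ m := by
    rw [hind.mgf_sum (fun i => measurable_pi_apply i)]
    have : ∀ i : ℕ, mgf (fun T : ℕ → ℝ => T i) (holdLaw n) (-(1 / t))
        = ((n : ℕ) : ℝ) ^ 2 / (((n : ℕ) : ℝ) ^ 2 + 1 / t) := by
      intro i
      rw [← mgf_expMeasure hr (by positivity : 0 ≤ 1 / t)]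
      have h := (measurePreserving_eval_infinitePi
        (fun _ : ℕ => expMeasure (((n : ℕ) : ℝ) ^ 2)) i)
      rw [← mgf_id_map (measurable_pi_apply i).aemeasurable]
      congr 1
      exact h.map_eq
    rw [Finset.prod_congr rfl fun i _ => this i, Finset.prod_const, Finset.card_range]
  have hint : Integrable (fun T => Real.exp (-(1 / t) *
      (∑ i ∈ Finset.range m, fun T : ℕ → ℝ => T i) T)) (holdLaw n) := by
    refine Integrable.of_bound ?_ 1 ?_
    · refine Measurable.aestronglyMeasurable ?_
      simp only [Finset.sum_apply]
      exact ((measurable_partialSum m).const_mul _).exp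
    · filter_upwards [ae_pos_holdLaw n] with T hT
      rw [Real.norm_of_nonneg (Real.exp_pos _).le, Real.exp_le_one_iff, Finset.sum_apply]
      have : 0 ≤ 1 / t * ∑ i ∈ Finset.range m, T i :=
        mul_nonneg (by positivity) (Finset.sum_nonneg fun i _ => (hT i).le)
      linarith
  have h := measure_le_le_exp_mul_mgf t (by simpa using ht.le : -(1 / t) ≤ 0) hint
  rw [hmgf] at h
  rw [show -(-(1 / t)) * t = 1 by field_simp] at h
  rw [← ofReal_measureReal]
  refine ENNReal.ofReal_le_ofReal (le_trans (le_of_eq ?_) h)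
  simp only [Finset.sum_apply]

/-- The number of steps taken up to time `t`, as a function of the holding times. -/
noncomputable def countSteps (t : ℝ≥0) (T : ℕ → ℝ) : ℕ :=
  {m : ℕ | ∑ i ∈ Finset.range (m + 1), T i ≤ (t : ℝ)}.ncard

lemma measurable_countSteps (t : ℝ≥0) : Measurable (countSteps t) := by
  refine measurable_ncard.comp (measurable_set_iff.2 fun m => ?_)
  exact measurableSet_setOfPred.1 (measurableSet_le (measurable_partialSum (m + 1)) measurable_const)

/-- The expected count is bounded by the sum of the probabilities that each jump occurs by time `t`,
and the Chernoff bounds form a geometric series. The factor `exp 1` is harmless; only the order `n ^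
2 * t` matters. -/
lemma lintegral_countSteps_le (n : ℕ+) {t : ℝ≥0} (ht : 0 < t) :
    ∫⁻ T, (countSteps t T : ℝ≥0∞) ∂holdLaw n
      ≤ ENNReal.ofReal (Real.exp 1 * ((n : ℕ) : ℝ) ^ 2 * t) := by
  have hr := rate_pos n
  have ht' : (0 : ℝ) < t := ht
  have hS : ∀ m : ℕ, MeasurableSet {T : ℕ → ℝ | ∑ i ∈ Finset.range (m + 1), T i ≤ (t : ℝ)} :=
    fun m => measurableSet_le (measurable_partialSum (m + 1)) measurable_const
  have h1 : ∀ T, (countSteps t T : ℝ≥0∞) ≤ ∑' m : ℕ,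
      {T : ℕ → ℝ | ∑ i ∈ Finset.range (m + 1), T i ≤ (t : ℝ)}.indicator 1 T := by
    intro T
    have h2 : (countSteps t T : ℕ∞)
        ≤ {m : ℕ | ∑ i ∈ Finset.range (m + 1), T i ≤ (t : ℝ)}.encard := Set.ncard_le_encard _
    have h3 : (countSteps t T : ℝ≥0∞) ≤
        ({m : ℕ | ∑ i ∈ Finset.range (m + 1), T i ≤ (t : ℝ)}.encard : ℝ≥0∞) := by
      exact_mod_cast ENat.toENNReal_le.2 h2
    refine h3.trans (le_of_eq ?_)
    rw [← ENNReal.tsum_set_one, tsum_subtype _ (fun _ => (1 : ℝ≥0∞))]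
    rfl
  set ρ : ℝ := ((n : ℕ) : ℝ) ^ 2 / (((n : ℕ) : ℝ) ^ 2 + 1 / t) with hρ
  have hρ0 : 0 ≤ ρ := by positivity
  have hρ1 : ρ < 1 := by
    rw [hρ, div_lt_one (by positivity)]
    have : 0 < 1 / (t : ℝ) := by positivity
    linarith
  have hsum : HasSum (fun m : ℕ => Real.exp 1 * ρ ^ (m + 1))
      (Real.exp 1 * ((n : ℕ) : ℝ) ^ 2 * t) := by
    have h := (hasSum_geometric_of_lt_one hρ0 hρ1).mul_left (Real.exp 1 * ρ)
    have e : Real.exp 1 * ρ * (1 - ρ)⁻¹ = Real.exp 1 * ((n : ℕ) : ℝ) ^ 2 * t := by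
      have h1ρ : 1 - ρ = 1 / (((n : ℕ) : ℝ) ^ 2 * t + 1) := by
        rw [hρ]
        field_simp
        ring
      rw [h1ρ, hρ]
      field_simp
    rw [e] at h
    refine h.congr_fun ?_
    intro m
    ring
  calc ∫⁻ T, (countSteps t T : ℝ≥0∞) ∂holdLaw n
      ≤ ∫⁻ T, ∑' m : ℕ,
        {T : ℕ → ℝ | ∑ i ∈ Finset.range (m + 1), T i ≤ (t : ℝ)}.indicator 1 T ∂holdLaw n :=
        lintegral_mono h1
    _ = ∑' m : ℕ, holdLaw n {T : ℕ → ℝ | ∑ i ∈ Finset.range (m + 1), T i ≤ (t : ℝ)} := by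
        rw [lintegral_tsum fun m => (measurable_one.indicator (hS m)).aemeasurable]
        exact tsum_congr fun m => lintegral_indicator_one (hS m)
    _ ≤ ∑' m : ℕ, ENNReal.ofReal (Real.exp 1 * ρ ^ (m + 1)) :=
        ENNReal.tsum_le_tsum fun m => holdLaw_partialSum_le_le n (m + 1) ht'
    _ = ENNReal.ofReal (Real.exp 1 * ((n : ℕ) : ℝ) ^ 2 * t) := by
        rw [← ENNReal.ofReal_tsum_of_nonneg (fun m => by positivity) hsum.summable, hsum.tsum_eq]

/-- If the holding times are positive, then exactly `m` steps have been taken at the time of the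
`m`-th step. -/
lemma countSteps_partialSum {T : ℕ → ℝ} (hT : ∀ i, 0 < T i) (m : ℕ) :
    countSteps (∑ i ∈ Finset.range m, T i).toNNReal T = m := by
  have hmono : StrictMono fun m => ∑ i ∈ Finset.range m, T i :=
    strictMono_nat_of_lt_succ fun m => by
      simp only [Finset.sum_range_succ]
      linarith [hT m]
  have h : {k : ℕ | ∑ i ∈ Finset.range (k + 1), T i
      ≤ ((∑ i ∈ Finset.range m, T i).toNNReal : ℝ)} = Set.Iio m := by
    ext k
    rw [Real.coe_toNNReal _ (Finset.sum_nonneg fun i _ => (hT i).le)]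
    exact hmono.le_iff_le.trans Nat.succ_le_iff
  rw [countSteps, h, ← Finset.coe_range, Set.ncard_coe_finset, Finset.card_range]

lemma countSteps_zero {T : ℕ → ℝ} (hT : ∀ i, 0 < T i) : countSteps 0 T = 0 := by
  simpa using countSteps_partialSum hT 0

end Holding

/-! ### The continuous-time walk on the circle -/

section Walk

variable (n : ℕ+)

lemma P_eq : P n = (uniformOn (Set.univ : Set (ZMod n))).prod (stepLaw.prod (holdLaw n)) := rfl

variable {n}

lemma Y_eq (t : ℝ≥0) (ω : Path n) :
    Y n t ω = ω.1 + ((walk ω.2.1 (countSteps t ω.2.2) : ℤ) : ZMod n) := by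
  simp only [walk, Int.cast_sum]
  rfl

variable (n)

lemma ae_pos_P : ∀ᵐ ω ∂P n, ∀ i, 0 < ω.2.2 i := by
  rw [P_eq]
  exact (Measure.quasiMeasurePreserving_snd.comp Measure.quasiMeasurePreserving_snd).ae
    (ae_pos_holdLaw n)

/-- Only almost sure: the sample space also contains nonpositive holding times, for which steps may
be counted at time `0`. -/
lemma ae_Y_zero_eq : ∀ᵐ ω ∂P n, Y n 0 ω = ω.1 := by
  filter_upwards [ae_pos_P n] with ω hω
  rw [Y_eq, countSteps_zero hω, walk_zero, Int.cast_zero, add_zero]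

lemma uniformOn_ne (f g : ZMod n → Sgn) :
    uniformOn (Set.univ : Set (ZMod n)) {x | f x ≠ g x}
      = ENNReal.ofReal (disagree f g / (n : ℕ)) := by
  rw [uniformOn_univ, ZMod.card, ENNReal.ofReal_div_of_pos (Nat.cast_pos.2 n.pos),
    ENNReal.ofReal_natCast, ENNReal.ofReal_natCast]
  congr 1
  have : {x | f x ≠ g x} = ((Finset.univ.filter fun x => f x ≠ g x : Finset (ZMod n)) : Set _) := by
    ext x
    simp
  rw [this, Measure.count_apply_finset]
  rfl

lemma P_ne_Y_zero (f g : ZMod n → Sgn) :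
    P n {ω | f (Y n 0 ω) ≠ g (Y n 0 ω)} = ENNReal.ofReal (disagree f g / (n : ℕ)) := by
  have h : ({ω | f (Y n 0 ω) ≠ g (Y n 0 ω)} : Set (Path n)) =ᵐ[P n]
      Prod.fst ⁻¹' {x | f x ≠ g x} := by
    filter_upwards [ae_Y_zero_eq n] with ω hω
    apply propext
    change f (Y n 0 ω) ≠ g (Y n 0 ω) ↔ f ω.1 ≠ g ω.1
    rw [hω]
  rw [measure_congr h, P_eq, measurePreserving_fst.measure_preimage
    (MeasurableSet.of_discrete).nullMeasurableSet, uniformOn_ne]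

/-- The displacement of the walk on `ℤ` at time `t`. -/
noncomputable def displacement (t : ℝ≥0) (q : (ℕ → Sgn) × (ℕ → ℝ)) : ℤ :=
  walk q.1 (countSteps t q.2)

lemma measurable_displacement (t : ℝ≥0) : Measurable (displacement t) := by
  have h : Measurable fun p : (ℕ → Sgn) × ℕ => walk p.1 p.2 :=
    measurable_from_prod_countable_left fun m => measurable_walk m
  exact h.comp (measurable_fst.prodMk ((measurable_countSteps t).comp measurable_snd))

lemma lintegral_walk_sq (m : ℕ) :
    ∫⁻ σ, ENNReal.ofReal ((walk σ m : ℝ) ^ 2) ∂stepLaw = m := by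
  rw [← ofReal_integral_eq_lintegral_ofReal (integrable_walk_sq m)
    (ae_of_all _ fun σ => sq_nonneg _), integral_walk_sq m, ENNReal.ofReal_natCast]

/-- Given the holding times, the mean squared displacement is exactly the number of steps. -/
lemma lintegral_displacement_sq_le {t : ℝ≥0} (ht : 0 < t) :
    ∫⁻ q, ENNReal.ofReal ((displacement t q : ℝ) ^ 2) ∂(stepLaw.prod (holdLaw n))
      ≤ ENNReal.ofReal (Real.exp 1 * ((n : ℕ) : ℝ) ^ 2 * t) := by
  refine le_trans (le_of_eq ?_) (lintegral_countSteps_le n ht)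
  have hm : Measurable fun q => ENNReal.ofReal ((displacement t q : ℝ) ^ 2) :=
    (Measurable.of_discrete (f := fun z : ℤ => ENNReal.ofReal ((z : ℝ) ^ 2))).comp
      (measurable_displacement t)
  rw [lintegral_prod_symm _ hm.aemeasurable]
  refine lintegral_congr fun T => ?_
  exact lintegral_walk_sq (countSteps t T)

/-- Pass from `f` to `h`, shift `h`, and return to the shifted `f`. The factor `|z|` is replaced by
`c / 2 + z ^ 2 / (2 * c)`, so that a second moment suffices. -/
lemma disagree_intCast_translate_le_of_approx (f h : ZMod n → Sgn) (z : ℤ) {c : ℝ} (hc : 0 < c) :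
    (disagree f (fun x => f (x + (z : ZMod n))) : ℝ) ≤ (2 * disagree f h +
      disagree h (fun x => h (x + 1)) * (c / 2)) +
        disagree h (fun x => h (x + 1)) / (2 * c) * (z : ℝ) ^ 2 := by
  have h1 := disagree_triangle f h (fun x => f (x + (z : ZMod n)))
  have h2 := disagree_triangle h (fun x => h (x + (z : ZMod n))) (fun x => f (x + (z : ZMod n)))
  have h3 := disagree_translate h f (z : ZMod n)
  have h4 := disagree_intCast_translate_le h z
  rw [h3, disagree_comm h f] at h2
  have h5 : (disagree f (fun x => f (x + (z : ZMod n))) : ℝ)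
      ≤ 2 * disagree f h + z.natAbs * disagree h (fun x => h (x + 1)) := by
    exact_mod_cast (by omega : disagree f (fun x => f (x + (z : ZMod n)))
      ≤ 2 * disagree f h + z.natAbs * disagree h (fun x => h (x + 1)))
  have h6 : (z.natAbs : ℝ) ≤ c / 2 + (z : ℝ) ^ 2 / (2 * c) := by
    rw [Nat.cast_natAbs, Int.cast_abs, ← sq_abs (z : ℝ)]
    have h7 : c / 2 + |(z : ℝ)| ^ 2 / (2 * c) - |(z : ℝ)| = (|(z : ℝ)| - c) ^ 2 / (2 * c) := by
      field_simp
      ring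
    have h8 : 0 ≤ (|(z : ℝ)| - c) ^ 2 / (2 * c) := by positivity
    linarith
  calc _ ≤ _ := h5
    _ ≤ 2 * disagree f h
        + (c / 2 + (z : ℝ) ^ 2 / (2 * c)) * disagree h (fun x => h (x + 1)) := by gcongr
    _ = _ := by ring

/-- If `f` is approximated by a function `h` with few sign changes, then `f` is stable under small
noise. -/
lemma P_ne_Y_le (f h : ZMod n → Sgn) {t : ℝ≥0} (ht : 0 < t) :
    P n {ω | f (Y n 0 ω) ≠ f (Y n t ω)} ≤ ENNReal.ofReal (2 * (disagree f h / (n : ℕ)) +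
      disagree h (fun x => h (x + 1)) * ((1 + Real.exp 1) / 2 * √t)) := by
  have hn : (0 : ℝ) < (n : ℕ) := Nat.cast_pos.2 n.pos
  have ht' : (0 : ℝ) < t := ht
  have hst : 0 < √(t : ℝ) := Real.sqrt_pos.2 ht'
  set a : ℝ := (disagree f h : ℝ)
  set b : ℝ := (disagree h (fun x => h (x + 1)) : ℝ)
  have ha : 0 ≤ a := Nat.cast_nonneg _
  have hb : 0 ≤ b := Nat.cast_nonneg _
  -- The typical displacement, which balances the two terms of the quadratic bound.
  set c : ℝ := (n : ℕ) * √(t : ℝ) with hc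
  have hc0 : 0 < c := mul_pos hn hst
  set E : Set (Path n) :=
    {ω | f ω.1 ≠ f (ω.1 + ((displacement t ω.2 : ℤ) : ZMod n))} with hE
  have hEm : MeasurableSet E := by
    have hm : Measurable fun ω : Path n => (ω.1, displacement t ω.2) :=
      measurable_fst.prodMk ((measurable_displacement t).comp measurable_snd)
    exact hm (MeasurableSet.of_discrete
      (s := {p : ZMod n × ℤ | f p.1 ≠ f (p.1 + (p.2 : ZMod n))}))
  have h1 : ({ω | f (Y n 0 ω) ≠ f (Y n t ω)} : Set (Path n)) =ᵐ[P n] E := by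
    filter_upwards [ae_Y_zero_eq n] with ω hω
    apply propext
    change f (Y n 0 ω) ≠ f (Y n t ω) ↔ f ω.1 ≠ f (ω.1 + ((displacement t ω.2 : ℤ) : ZMod n))
    rw [hω, Y_eq]
    rfl
  have hmz : Measurable fun q => ENNReal.ofReal ((displacement t q : ℝ) ^ 2) :=
    (Measurable.of_discrete (f := fun z : ℤ => ENNReal.ofReal ((z : ℝ) ^ 2))).comp
      (measurable_displacement t)
  rw [measure_congr h1, P_eq, Measure.prod_apply_symm hEm]
  calc ∫⁻ q, uniformOn Set.univ ((fun x => (x, q)) ⁻¹' E) ∂(stepLaw.prod (holdLaw n))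
      ≤ ∫⁻ q, (ENNReal.ofReal ((2 * a + b * (c / 2)) / (n : ℕ)) +
          ENNReal.ofReal (b / (2 * c) / (n : ℕ)) * ENNReal.ofReal ((displacement t q : ℝ) ^ 2))
            ∂(stepLaw.prod (holdLaw n)) := by
        refine lintegral_mono fun q => ?_
        refine (uniformOn_ne n f (fun x => f (x + ((displacement t q : ℤ) : ZMod n)))).le.trans ?_
        rw [← ENNReal.ofReal_mul (by positivity), ← ENNReal.ofReal_add (by positivity)
          (by positivity)]
        refine ENNReal.ofReal_le_ofReal ?_
        rw [div_mul_eq_mul_div, ← add_div]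
        gcongr
        exact disagree_intCast_translate_le_of_approx n f h _ hc0
    _ = ENNReal.ofReal ((2 * a + b * (c / 2)) / (n : ℕ)) +
          ENNReal.ofReal (b / (2 * c) / (n : ℕ)) *
            ∫⁻ q, ENNReal.ofReal ((displacement t q : ℝ) ^ 2) ∂(stepLaw.prod (holdLaw n)) := by
        rw [lintegral_add_left measurable_const, lintegral_const_mul _ hmz, lintegral_const,
          measure_univ, mul_one]
    _ ≤ ENNReal.ofReal ((2 * a + b * (c / 2)) / (n : ℕ)) +
          ENNReal.ofReal (b / (2 * c) / (n : ℕ)) *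
            ENNReal.ofReal (Real.exp 1 * ((n : ℕ) : ℝ) ^ 2 * t) := by
        gcongr
        exact lintegral_displacement_sq_le n ht
    _ = ENNReal.ofReal (2 * (a / (n : ℕ)) + b * ((1 + Real.exp 1) / 2 * √t)) := by
        rw [← ENNReal.ofReal_mul (by positivity), ← ENNReal.ofReal_add (by positivity)
          (by positivity)]
        congr 1
        have h2 : (t : ℝ) = √(t : ℝ) ^ 2 := (Real.sq_sqrt ht'.le).symm
        rw [hc]
        conv_lhs => rw [h2]
        rw [Real.sqrt_sq hst.le]
        field_simp
        ring

lemma exists_walk_eq_of_nonneg (σ : ℕ → Sgn) {z : ℤ} (hz : 0 ≤ z) :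
    ∀ i, z ≤ walk σ i → ∃ j ≤ i, walk σ j = z
  | 0, h => ⟨0, le_rfl, le_antisymm (by rwa [walk_zero]) h⟩
  | i + 1, h => by
    by_cases h' : z ≤ walk σ i
    · obtain ⟨j, hj, e⟩ := exists_walk_eq_of_nonneg σ hz i h'
      exact ⟨j, by omega, e⟩
    · refine ⟨i + 1, le_rfl, ?_⟩
      have h2 := walk_succ σ i
      rcases Int.units_eq_one_or (σ i) with h1 | h1 <;> rw [h1] at h2 <;> simp at h2 <;> omega

lemma exists_walk_eq_of_nonpos (σ : ℕ → Sgn) {z : ℤ} (hz : z ≤ 0) :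
    ∀ i, walk σ i ≤ z → ∃ j ≤ i, walk σ j = z
  | 0, h => ⟨0, le_rfl, le_antisymm h (by rwa [walk_zero])⟩
  | i + 1, h => by
    by_cases h' : walk σ i ≤ z
    · obtain ⟨j, hj, e⟩ := exists_walk_eq_of_nonpos σ hz i h'
      exact ⟨j, by omega, e⟩
    · refine ⟨i + 1, le_rfl, ?_⟩
      have h2 := walk_succ σ i
      rcases Int.units_eq_one_or (σ i) with h1 | h1 <;> rw [h1] at h2 <;> simp at h2 <;> omega

/-- Up to time `δ` at least `M` steps are made and only one value of `g` is seen. A path reaching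
distance `L` visits every point in between, hence `L + 1` consecutive points on one side of the
start. -/
lemma exists_arc_eq_of_lt_tau {g : ZMod n → Sgn} {δ : ℝ≥0} {L M : ℕ} {ω : Path n}
    (hω : ∀ i, 0 < ω.2.2 i) (hM : ∑ i ∈ Finset.range M, ω.2.2 i ≤ δ)
    (hτ : (δ : WithTop ℝ≥0) < tau n g ω) (hL : ω.2.1 ∉ staysWithin L M) :
    ∃ x s, ∀ y ∈ arc x (L + 1), g y = s := by
  have hg : ∀ j ≤ M, g (ω.1 + ((walk ω.2.1 j : ℤ) : ZMod n)) = g (Y n 0 ω) := by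
    intro j hj
    have hle : (∑ i ∈ Finset.range j, ω.2.2 i).toNNReal ≤ δ := by
      rw [Real.toNNReal_le_iff_le_coe]
      refine le_trans ?_ hM
      exact Finset.sum_le_sum_of_subset_of_nonneg (Finset.range_subset_range.2 hj)
        fun i _ _ => (hω i).le
    have h := notMem_of_lt_hittingAfter
      ((WithTop.coe_le_coe.2 hle).trans_lt hτ) zero_le
    rw [Set.mem_ofPred_eq, not_not, Y_eq _ ω, countSteps_partialSum hω] at h
    exact h
  simp only [staysWithin, Set.mem_ofPred_eq, not_forall, not_lt] at hL
  obtain ⟨i, hi, hLi⟩ := hL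
  rcases le_total 0 (walk ω.2.1 i) with h0 | h0
  · rw [abs_of_nonneg h0] at hLi
    refine ⟨ω.1, g (Y n 0 ω), fun y hy => ?_⟩
    obtain ⟨k, hk, rfl⟩ := mem_arc.1 hy
    obtain ⟨j, hj, e⟩ := exists_walk_eq_of_nonneg ω.2.1 (z := k) (by omega) i (by omega)
    rw [← hg j (hj.trans hi), e, Int.cast_natCast]
  · rw [abs_of_nonpos h0] at hLi
    refine ⟨ω.1 - (L : ZMod n), g (Y n 0 ω), fun y hy => ?_⟩
    obtain ⟨k, hk, rfl⟩ := mem_arc.1 hy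
    obtain ⟨j, hj, e⟩ := exists_walk_eq_of_nonpos ω.2.1 (z := (k : ℤ) - L) (by omega) i (by omega)
    rw [← hg j (hj.trans hi), e]
    congr 1
    push_cast
    ring

/-- If `g` is not constant on any arc of length `L + 1`, then its boundary is hit quickly. -/
lemma P_lt_tau_le {g : ZMod n → Sgn} {δ : ℝ≥0} (hδ : 0 < δ) {L M : ℕ} (hM : 0 < M)
    (hg : ∀ x s, ¬ ∀ y ∈ arc x (L + 1), g y = s) :
    P n {ω | (δ : WithTop ℝ≥0) < tau n g ω}
      ≤ ENNReal.ofReal (M / (((n : ℕ) : ℝ) ^ 2 * δ) + (L : ℝ) ^ 2 / M) := by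
  have hM' : (0 : ℝ) < M := Nat.cast_pos.2 hM
  set A : Set (Path n) :=
    (fun ω => ω.2.2) ⁻¹' {T : ℕ → ℝ | (δ : ℝ) < ∑ i ∈ Finset.range M, T i} with hA
  set B : Set (Path n) := (fun ω => ω.2.1) ⁻¹' staysWithin L M with hB
  have hsub : ({ω | (δ : WithTop ℝ≥0) < tau n g ω} : Set (Path n)) ≤ᵐ[P n] (A ∪ B : Set _) := by
    filter_upwards [ae_pos_P n] with ω hω hτ
    by_contra hc
    have hc' : ω ∉ A ∪ B := hc
    rw [Set.mem_union, not_or] at hc'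
    obtain ⟨x, s, h⟩ := exists_arc_eq_of_lt_tau n hω (not_lt.1 hc'.1) hτ hc'.2
    exact hg x s h
  have hmpA : MeasurePreserving (fun ω : Path n => ω.2.2) (P n) (holdLaw n) :=
    measurePreserving_snd.comp measurePreserving_snd
  have hmpB : MeasurePreserving (fun ω : Path n => ω.2.1) (P n) stepLaw :=
    measurePreserving_fst.comp measurePreserving_snd
  have h1 : P n A ≤ ENNReal.ofReal (M / (((n : ℕ) : ℝ) ^ 2 * δ)) := by
    rw [hA, hmpA.measure_preimage
      (measurableSet_lt measurable_const (measurable_partialSum M)).nullMeasurableSet]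
    exact holdLaw_lt_partialSum_le n M hδ
  have h2 : P n B ≤ ENNReal.ofReal ((L : ℝ) ^ 2 / M) := by
    rw [hB, hmpB.measure_preimage (measurableSet_staysWithin L M).nullMeasurableSet,
      ← ofReal_measureReal]
    refine ENNReal.ofReal_le_ofReal ?_
    rw [le_div_iff₀ hM', mul_comm]
    exact mul_measure_staysWithin_le L M
  calc P n {ω | (δ : WithTop ℝ≥0) < tau n g ω} ≤ P n (A ∪ B) := measure_mono_ae hsub
    _ ≤ P n A + P n B := measure_union_le _ _
    _ ≤ _ := add_le_add h1 h2
    _ = _ := (ENNReal.ofReal_add (by positivity) (by positivity)).symm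

lemma mean_eq (f : ZMod n → Sgn) : mean n f = 1 - 2 * (disagree f 1 / (n : ℕ)) := by
  have h : ∀ᵐ ω ∂P n, (((f (Y n 0 ω) : Sgn) : ℤ) : ℝ)
      = 1 - 2 * (Prod.fst ⁻¹' {x | f x ≠ (1 : ZMod n → Sgn) x} : Set (Path n)).indicator 1 ω := by
    filter_upwards [ae_Y_zero_eq n] with ω hω
    rw [hω]
    rcases Int.units_eq_one_or (f ω.1) with h1 | h1
    · rw [Set.indicator_of_notMem (by simp [h1]), h1]
      simp
    · rw [Set.indicator_of_mem (by simp [h1]), h1]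
      norm_num
  have hm : MeasurableSet (Prod.fst ⁻¹' {x | f x ≠ (1 : ZMod n → Sgn) x} : Set (Path n)) :=
    measurable_fst .of_discrete
  have hr : (P n).real (Prod.fst ⁻¹' {x | f x ≠ (1 : ZMod n → Sgn) x})
      = disagree f 1 / (n : ℕ) := by
    rw [measureReal_def, P_eq, measurePreserving_fst.measure_preimage
      (MeasurableSet.of_discrete).nullMeasurableSet, uniformOn_ne,
      ENNReal.toReal_ofReal (by positivity)]
  have hi : Integrable ((Prod.fst ⁻¹' {x | f x ≠ (1 : ZMod n → Sgn) x} :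
      Set (Path n)).indicator (1 : Path n → ℝ)) (P n) := (integrable_const (1 : ℝ)).indicator hm
  rw [mean, integral_congr_ae h, integral_sub (integrable_const _) (hi.const_mul 2),
    integral_const_mul, integral_indicator_one hm, hr]
  simp

lemma disagree_one_add_disagree_neg_one (f : ZMod n → Sgn) :
    disagree f 1 + disagree f (-1) = (n : ℕ) := by
  have h : (Finset.univ.filter fun x => f x ≠ (-1 : ZMod n → Sgn) x)
      = Finset.univ.filter fun x => ¬ f x ≠ (1 : ZMod n → Sgn) x := by
    refine Finset.filter_congr fun x _ => ?_
    rcases Int.units_eq_one_or (f x) with h1 | h1 <;> simp [h1]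
  rw [disagree, disagree, h, Finset.card_filter_add_card_filter_not, Finset.card_univ, ZMod.card]

end Walk

/-! ### The three properties of the layered sequence -/

section Sequence

lemma eventually_le_coe (N : ℕ) : ∀ᶠ n : ℕ+ in atTop, N ≤ (n : ℕ) := by
  filter_upwards [eventually_ge_atTop N.succPNat] with n hn
  have h : (N.succPNat : ℕ) ≤ n := hn
  rw [Nat.succPNat_coe] at h
  omega

lemma tendsto_zero_of_forall_ofReal {α : Type*} {l : Filter α} {u : α → ℝ≥0∞}
    (h : ∀ η : ℝ, 0 < η → ∀ᶠ a in l, u a ≤ ENNReal.ofReal η) : Tendsto u l (𝓝 0) := by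
  rw [ENNReal.tendsto_nhds_zero]
  intro ε hε
  obtain ⟨η, h0, h1⟩ := ENNReal.lt_iff_exists_nnreal_btwn.1 hε
  filter_upwards [h η (by exact_mod_cast h0)] with a ha
  rw [ENNReal.ofReal_coe_nnreal] at ha
  exact ha.trans h1.le

/-- The sequence of layered functions, with all layers that are nonempty. -/
def layeredSeq (d : ℕ → (ℕ × ℕ) × Sgn) : FunSeq := fun n => layered d n n

variable {d : ℕ → (ℕ × ℕ) × Sgn}

lemma noiseStable_layeredSeq (d : ℕ → (ℕ × ℕ) × Sgn) : NoiseStable (layeredSeq d) := by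
  refine tendsto_zero_of_forall_ofReal fun η hη => ?_
  obtain ⟨K, hK⟩ := exists_pow_lt_of_lt_one (half_pos hη) (by norm_num : (1 / 4 : ℝ) < 1)
  have hlim : Tendsto (fun t : ℝ≥0 => 2 * (K : ℝ) * ((1 + Real.exp 1) / 2 * √(t : ℝ)))
      (𝓝[>] 0) (𝓝 0) := by
    have hc : Continuous fun t : ℝ≥0 => 2 * (K : ℝ) * ((1 + Real.exp 1) / 2 * √(t : ℝ)) := by
      fun_prop
    have h := hc.tendsto 0
    simp only [NNReal.coe_zero, Real.sqrt_zero, mul_zero] at h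
    exact h.mono_left nhdsWithin_le_nhds
  filter_upwards [hlim.eventually_lt_const (half_pos hη), self_mem_nhdsWithin] with t ht ht0
  refine iSup_le fun n => ?_
  have hn : (0 : ℝ) < (n : ℕ) := Nat.cast_pos.2 n.pos
  -- The supremum includes `n < K`, where only `n` layers exist and the approximation is exact.
  refine (P_ne_Y_le n (layeredSeq d n) (layered d n (min K n)) ht0).trans
    (ENNReal.ofReal_le_ofReal ?_)
  have h1 : (disagree (layeredSeq d n) (layered d n (min K n)) : ℝ) / (n : ℕ)
      ≤ (1 / 4) ^ K / 3 := by
    rw [div_le_iff₀ hn, disagree_comm]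
    rcases le_total K (n : ℕ) with h | h
    · rw [min_eq_left h]
      refine (disagree_layered_le_div d n K n h).trans (le_of_eq ?_)
      rw [one_div, inv_pow]
      field_simp
    · rw [min_eq_right h]
      change (disagree (layered d n n) (layered d n n) : ℝ) ≤ _
      rw [disagree_self, Nat.cast_zero]
      positivity
  have h2 : (disagree (layered d n (min K n)) (fun x => layered d n (min K n) (x + 1)) : ℝ)
      ≤ 2 * K := by
    have := (disagree_layered_translate_le d n (min K n)).trans
      (Nat.mul_le_mul_left 2 (min_le_left K n))
    exact_mod_cast this
  have h3 : (disagree (layered d n (min K n)) (fun x => layered d n (min K n) (x + 1)) : ℝ) *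
      ((1 + Real.exp 1) / 2 * √(t : ℝ)) ≤ 2 * K * ((1 + Real.exp 1) / 2 * √(t : ℝ)) := by
    gcongr
  have h4 : (0 : ℝ) ≤ (1 / 4) ^ K := by positivity
  linarith

lemma nondegenerate_layeredSeq (hd : ∀ p m, ∃ k ≥ m, d k = p) :
    Nondegenerate (layeredSeq d) := by
  -- With `R = 1` the arcs cover the whole circle, so this applies to constant functions of either
  -- sign.
  obtain ⟨C, hC⟩ := exists_le_mul_disagree_layered hd one_pos
  have hbound : ∀ᶠ n : ℕ+ in atTop, -1 + 2 / ((C : ℝ) + 1) ≤ mean n (layeredSeq d n) ∧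
      mean n (layeredSeq d n) ≤ 1 - 2 / ((C : ℝ) + 1) := by
    filter_upwards [eventually_le_coe C] with n hn
    have hn0 : (0 : ℝ) < (n : ℕ) := Nat.cast_pos.2 n.pos
    have key : ∀ s : Sgn, 1 / ((C : ℝ) + 1)
        ≤ (disagree (layeredSeq d n) (fun _ => s) : ℝ) / (n : ℕ) := by
      intro s
      have h : ((n : ℕ) : ℝ) ≤ C * disagree (layeredSeq d n) (fun _ => s) := by
        exact_mod_cast hC n hn (fun _ => s) 0 s fun _ _ => rfl
      rw [div_le_div_iff₀ (by positivity) hn0]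
      have : (0 : ℝ) ≤ disagree (layeredSeq d n) (fun _ => s) := Nat.cast_nonneg _
      linarith
    have h1 : (disagree (layeredSeq d n) 1 : ℝ) / (n : ℕ)
        + disagree (layeredSeq d n) (-1) / (n : ℕ) = 1 := by
      rw [← add_div, div_eq_one_iff_eq hn0.ne']
      exact_mod_cast disagree_one_add_disagree_neg_one n (layeredSeq d n)
    have h2 : 1 / ((C : ℝ) + 1) ≤ (disagree (layeredSeq d n) 1 : ℝ) / (n : ℕ) := key 1
    have h3 : 1 / ((C : ℝ) + 1) ≤ (disagree (layeredSeq d n) (-1) : ℝ) / (n : ℕ) := key (-1)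
    rw [mean_eq, show (2 : ℝ) / (C + 1) = 2 * (1 / (C + 1)) by ring]
    constructor <;> linarith
  have hpos : 0 < 2 / ((C : ℝ) + 1) := by positivity
  have hle : IsBoundedUnder (· ≤ ·) atTop fun n : ℕ+ => mean n (layeredSeq d n) :=
    isBoundedUnder_of_eventually_le (hbound.mono fun _ h => h.2)
  have hge : IsBoundedUnder (· ≥ ·) atTop fun n : ℕ+ => mean n (layeredSeq d n) :=
    isBoundedUnder_of_eventually_ge (hbound.mono fun _ h => h.1)
  refine ⟨?_, liminf_le_limsup hle hge, ?_⟩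
  · have := le_liminf_of_le hle.isCoboundedUnder_ge (hbound.mono fun _ h => h.1)
    linarith
  · have := limsup_le_of_le hge.isCoboundedUnder_le (hbound.mono fun _ h => h.2)
    linarith

lemma volatile_of_close_layeredSeq (hd : ∀ p m, ∃ k ≥ m, d k = p) {g : FunSeq}
    (hg : Close (layeredSeq d) g) : Volatile g := by
  intro δ hδ
  refine tendsto_zero_of_forall_ofReal fun η hη => ?_
  have hδ' : (0 : ℝ) < δ := hδ
  -- With `L ≤ 2 * n / R` and `M ≥ η * n ^ 2 * δ / 4`, this makes `L ^ 2 / M ≤ η / 2`. The `+ 1`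
  -- gives `R > 1`, hence `R ≤ R ^ 2`.
  obtain ⟨R, hR⟩ := exists_nat_gt (16 / (η / 2 * δ * (η / 2)) + 1)
  have hR1 : (1 : ℝ) < R := lt_of_le_of_lt (by
    have : 0 ≤ 16 / (η / 2 * δ * (η / 2)) := by positivity
    linarith) hR
  have hR0 : 0 < R := by exact_mod_cast one_pos.trans hR1
  obtain ⟨C, hC⟩ := exists_le_mul_disagree_layered hd hR0
  obtain ⟨N, hN⟩ := exists_nat_gt (2 / (η / 2 * δ))
  have hclose : ∀ᶠ n : ℕ+ in atTop,
      (disagree (layeredSeq d n) (g n) : ℝ) / (n : ℕ) < 1 / ((C : ℝ) + 1) := by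
    have hc : (0 : ℝ≥0∞) < ENNReal.ofReal (1 / ((C : ℝ) + 1)) :=
      ENNReal.ofReal_pos.2 (by positivity)
    filter_upwards [hg.eventually_lt_const hc] with n hn
    rw [P_ne_Y_zero] at hn
    exact (ENNReal.ofReal_lt_ofReal_iff (by positivity)).1 hn
  filter_upwards [hclose, eventually_le_coe C, eventually_le_coe N] with n hn hCn hNn
  have hn0 : (0 : ℝ) < (n : ℕ) := Nat.cast_pos.2 n.pos
  have hn1 : (1 : ℝ) ≤ (n : ℕ) := by exact_mod_cast n.pos
  have harc : ∀ x s, ¬ ∀ y ∈ arc x (2 * ((n : ℕ) / R) + 1), g n y = s := by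
    intro x s h
    have h1 : ((n : ℕ) : ℝ) ≤ C * disagree (layeredSeq d n) (g n) := by
      exact_mod_cast hC n hCn (g n) x s h
    rw [div_lt_div_iff₀ hn0 (by positivity)] at hn
    have : (0 : ℝ) ≤ disagree (layeredSeq d n) (g n) := Nat.cast_nonneg _
    linarith
  -- The number of steps before rounding, chosen so that the holding-time error is at most `η / 2`.
  -- Taking `n ≥ N` ensures `X ≥ 2`, so rounding down loses at most half.
  set X : ℝ := η / 2 * ((n : ℕ) ^ 2 * δ) with hX
  have hX2 : 2 ≤ X := by
    have h1 : 2 / (η / 2 * δ) ≤ ((n : ℕ) : ℝ) ^ 2 := by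
      calc 2 / (η / 2 * δ) ≤ N := hN.le
        _ ≤ (n : ℕ) := by exact_mod_cast hNn
        _ ≤ ((n : ℕ) : ℝ) ^ 2 := by nlinarith
    rw [div_le_iff₀ (by positivity)] at h1
    rw [hX]
    linarith
  have hM1 : (⌊X⌋₊ : ℝ) ≤ X := Nat.floor_le (by linarith)
  have hM2 : X / 2 ≤ ⌊X⌋₊ := by
    have := Nat.lt_floor_add_one X
    linarith
  have hM0 : (0 : ℝ) < ⌊X⌋₊ := by linarith
  refine (P_lt_tau_le n hδ (Nat.cast_pos.1 hM0) harc).trans (ENNReal.ofReal_le_ofReal ?_)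
  have h1 : (⌊X⌋₊ : ℝ) / (((n : ℕ) : ℝ) ^ 2 * δ) ≤ η / 2 := by
    rw [div_le_iff₀ (by positivity)]
    exact hM1
  have hL : ((2 * ((n : ℕ) / R) : ℕ) : ℝ) ≤ 2 * ((n : ℕ) / R) := by
    push_cast
    gcongr
    exact Nat.cast_div_le
  have hRR : 16 / (η / 2 * δ * (η / 2)) ≤ (R : ℝ) ^ 2 := by nlinarith
  have h2 : ((2 * ((n : ℕ) / R) : ℕ) : ℝ) ^ 2 / ⌊X⌋₊ ≤ η / 2 := by
    calc ((2 * ((n : ℕ) / R) : ℕ) : ℝ) ^ 2 / ⌊X⌋₊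
        ≤ (2 * ((n : ℕ) / R)) ^ 2 / (X / 2) := by gcongr
      _ = 8 / (η / 2 * δ) / (R : ℝ) ^ 2 := by
        rw [hX]
        field_simp
        norm_num
      _ ≤ η / 2 := by
        rw [div_le_iff₀ (by positivity)] at hRR
        rw [div_div, div_le_iff₀ (by positivity)]
        linarith
  linarith

lemma exists_forall_infinitely_often (α : Type*) [Countable α] [Nonempty α] :
    ∃ d : ℕ → α, ∀ p m, ∃ k ≥ m, d k = p := by
  obtain ⟨e, he⟩ := exists_surjective_nat α
  refine ⟨fun k => e (Nat.unpair k).1, fun p m => ?_⟩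
  obtain ⟨i, rfl⟩ := he p
  exact ⟨Nat.pair i m, Nat.right_le_pair i m, by simp⟩

end Sequence

end CircleWalk

theorem proposition3p3 :
    ∃ f : CircleWalk.FunSeq,
      CircleWalk.Nondegenerate f ∧ CircleWalk.NoiseStable f ∧ CircleWalk.Volatile f ∧
        ¬ ∃ g : CircleWalk.FunSeq, CircleWalk.Close f g ∧ ¬ CircleWalk.Volatile g := by
  obtain ⟨d, hd⟩ := CircleWalk.exists_forall_infinitely_often ((ℕ × ℕ) × CircleWalk.Sgn)
  -- This also yields volatility of the layered sequence, which is close to itself.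
  have hvol : ∀ g, CircleWalk.Close (CircleWalk.layeredSeq d) g → CircleWalk.Volatile g :=
    fun g hg => CircleWalk.volatile_of_close_layeredSeq hd hg
  refine ⟨CircleWalk.layeredSeq d, CircleWalk.nondegenerate_layeredSeq hd,
    CircleWalk.noiseStable_layeredSeq d, hvol _ ?_, fun ⟨g, hg, hng⟩ => hng (hvol g hg)⟩
  simp [CircleWalk.Close]
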